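/- A *Boolean algebra with operators* (BAO) of signature $\mathcal O$ (a possibly infinite set of finitary operation symbols) is a Boolean algebra with an interpretation of each $f\in\mathcal O$ as an operator, i.e. an operation that preserves all finite meets (including the empty meet $1$) in each coordinate. For a Boolean algebra $A$, its canonical extension $A^\sigma$ is its (unique up to isomorphism) dense and compact completion; for $f:A^n\to A$ and $x\in (A^\sigma)^n$, $$f^\sigma(x)=\bigvee\Big\{\bigwedge\{f(a)\mid a\in A^n,\ p\le a\le q\}\ \Big|\ p \text{ closed},\ q \text{ open},\ p\le x\le q\Big\},$$ where an element of $A^\sigma$ is closed (open) if it is a meet (join) of elements of $A$, closedness and openness of tuples are meant coordinatewise, and $f^\pi$ is defined by exchanging $\bigvee$ and $\bigwedge$. For each symbol of $\mathcal O$ it is fixed whether it is extended by $f^\sigma$ or by $f^\pi$; with these operations $A^\sigma$ is the canonical extension $\mathbf A^\sigma$ of a BAO $\mathbf A$. Let $\mathcal V$ be a variety of BAOs of signature $\mathcal O$. A term $t$ (over the Boolean operations and $\mathcal O$) is *expanding* if $t^{\mathbf A^\sigma}\ge (t^{\mathbf A})^\sigma$ for all $\mathbf A\in\mathcal V$. The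 variety $\mathcal V$ is *coherent* if every finitely generated subalgebra of a finitely presented member of $\mathcal V$ is finitely presented. A variety $\mathcal W$ has *equationally definable principal congruences* (EDPC) if there is a finite set $\Gamma$ of pairs of terms in four variables such that for all $\mathbf A\in\mathcal W$ and $a,b,c,d\in A$, the pair $(c,d)$ lies in the congruence of $\mathbf A$ generated by $(a,b)$ if and only if $p(a,b,c,d)=q(a,b,c,d)$ for all $(p,q)\in\Gamma$. **Theorem 5.2.** Let $\mathcal V$ be a variety of Boolean algebras with operators of signature $\mathcal O$ that is closed under canonical extensions. Let $\mathcal O'$ be a finite set of expanding terms, each of which interprets as an operator in every member of $\mathcal V$, and let $\mathcal V'$ be the variety generated by the term-reducts of members of $\mathcal V$ in the signature $\mathcal O'$ (the Boolean operations being kept). If $\mathcal V$ is coherent, then $\mathcal V'$ has EDPC. -/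

import Mathlib

universe u

namespace BAO

/-! ### Boolean algebras with additional operations -/

/-- A (possibly infinite) signature is a family `O : ℕ → Type u`; the elements of `O n` are the
`n`-ary operation symbols. The Boolean operations are always present in addition and are supplied
by Mathlib's `BooleanAlgebra`. `Ops O A` interprets the symbols of `O` on `A`. -/
class Ops (O : ℕ → Type u) (A : Type u) where
  /-- the interpretation of a symbol -/
  op : ∀ {n : ℕ}, O n → (Fin n → A) → A

/-- Terms over the Boolean operations and the signature `O`, with variables from `X`. -/
inductive BTerm (O : ℕ → Type u) (X : Type) : Type u where
  | var : X → BTerm O X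
  | bot : BTerm O X
  | top : BTerm O X
  | inf : BTerm O X → BTerm O X → BTerm O X
  | sup : BTerm O X → BTerm O X → BTerm O X
  | compl : BTerm O X → BTerm O X
  | app : ∀ {n : ℕ}, O n → (Fin n → BTerm O X) → BTerm O X

/-- The value of a term in an algebra under an assignment of the variables. -/
def BTerm.eval {O : ℕ → Type u} {X : Type} {A : Type u} [BooleanAlgebra A] [Ops O A]
    (v : X → A) : BTerm O X → A
  | .var x => v x
  | .bot => ⊥
  | .top => ⊤
  | .inf s t => s.eval v ⊓ t.eval v
  | .sup s t => s.eval v ⊔ t.eval v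
  | .compl t => (t.eval v)ᶜ
  | .app f ts => Ops.op f (fun i => (ts i).eval v)

/-- An `n`-ary operation on a Boolean algebra is a (multiplicative) operator if in each coordinate
it preserves all finite meets, that is, binary meets and the empty meet `⊤`. -/
def IsOperator {A : Type u} [BooleanAlgebra A] {n : ℕ} (f : (Fin n → A) → A) : Prop :=
  ∀ (i : Fin n) (v : Fin n → A),
    (∀ x y : A, f (Function.update v i (x ⊓ y)) =
      f (Function.update v i x) ⊓ f (Function.update v i y)) ∧
    f (Function.update v i ⊤) = ⊤

/-- A Boolean algebra with operators of signature `O`. -/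
def IsBAO (O : ℕ → Type u) (A : Type u) [BooleanAlgebra A] [Ops O A] : Prop :=
  ∀ (n : ℕ) (f : O n), IsOperator (Ops.op f : (Fin n → A) → A)

/-- `A` belongs to the variety axiomatized by the set `E` of equations. -/
def InVariety {O : ℕ → Type u} (E : Set (BTerm O ℕ × BTerm O ℕ))
    (A : Type u) [BooleanAlgebra A] [Ops O A] : Prop :=
  ∀ e ∈ E, ∀ v : ℕ → A, e.1.eval v = e.2.eval v

/-- The variety axiomatized by `E` is a variety of Boolean algebras with operators. -/
def IsBAOVariety {O : ℕ → Type u} (E : Set (BTerm O ℕ × BTerm O ℕ)) : Prop :=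
  ∀ (A : Type u) [BooleanAlgebra A] [Ops O A], InVariety E A → IsBAO O A

/-- Homomorphisms. (A bounded lattice homomorphism of Boolean algebras preserves complements.) -/
structure OpHom (O : ℕ → Type u) (A B : Type u) [BooleanAlgebra A] [Ops O A]
    [BooleanAlgebra B] [Ops O B] extends BoundedLatticeHom A B where
  map_op : ∀ {n : ℕ} (f : O n) (v : Fin n → A),
    toFun (Ops.op f v) = Ops.op f (fun i => toFun (v i))

/-! ### Congruences -/

/-- `r` is a congruence of the algebra `A`. -/
structure IsCongruence (O : ℕ → Type u) {A : Type u} [BooleanAlgebra A] [Ops O A]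
    (r : A → A → Prop) : Prop where
  equiv : Equivalence r
  inf : ∀ {a a' b b' : A}, r a a' → r b b' → r (a ⊓ b) (a' ⊓ b')
  sup : ∀ {a a' b b' : A}, r a a' → r b b' → r (a ⊔ b) (a' ⊔ b')
  compl : ∀ {a a' : A}, r a a' → r aᶜ a'ᶜ
  op : ∀ {n : ℕ} (f : O n) {v w : Fin n → A}, (∀ i, r (v i) (w i)) → r (Ops.op f v) (Ops.op f w)

/-- The congruence generated by a set `S` of pairs: the least congruence containing `S`. -/
def Cg (O : ℕ → Type u) {A : Type u} [BooleanAlgebra A] [Ops O A] (S : Set (A × A))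
    (c d : A) : Prop :=
  ∀ r : A → A → Prop, IsCongruence O r → (∀ p ∈ S, r p.1 p.2) → r c d

/-- The variety axiomatized by `E` has equationally definable principal congruences: there is a
finite set of equations `p(x,y,z,w) ≈ q(x,y,z,w)` which in every member, and for all `a b c d`,
hold at `(a,b,c,d)` if and only if `(c,d)` lies in the congruence generated by `(a,b)`. -/
def HasEDPC {O : ℕ → Type u} (E : Set (BTerm O ℕ × BTerm O ℕ)) : Prop :=
  ∃ Γ : Set (BTerm O (Fin 4) × BTerm O (Fin 4)), Γ.Finite ∧
    ∀ (A : Type u) [BooleanAlgebra A] [Ops O A], InVariety E A → ∀ a b c d : A,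
      (Cg O {(a, b)} c d ↔ ∀ e ∈ Γ, e.1.eval ![a, b, c, d] = e.2.eval ![a, b, c, d])

/-! ### Free algebras -/

/-- Two terms are identified if they have the same value throughout the variety. -/
def freeSetoid {O : ℕ → Type u} (E : Set (BTerm O ℕ × BTerm O ℕ)) (X : Type) :
    Setoid (BTerm O X) where
  r s t := ∀ (A : Type u) [BooleanAlgebra A] [Ops O A], InVariety E A →
    ∀ v : X → A, s.eval v = t.eval v
  iseqv :=
    { refl := fun _ _ _ _ _ _ => rfl
      symm := fun h A _ _ hA v => (h A hA v).symm
      trans := fun h k A _ _ hA v => (h A hA v).trans (k A hA v) }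

/-- The free algebra over `X` of the variety axiomatized by `E`. -/
def FreeAlg {O : ℕ → Type u} (E : Set (BTerm O ℕ × BTerm O ℕ)) (X : Type) : Type u :=
  Quotient (freeSetoid E X)

namespace FreeAlg

variable {O : ℕ → Type u} {E : Set (BTerm O ℕ × BTerm O ℕ)} {X : Type}

/-- The class of a term. -/
def mk (E : Set (BTerm O ℕ × BTerm O ℕ)) (t : BTerm O X) : FreeAlg E X :=
  Quotient.mk (freeSetoid E X) t

theorem sound {s t : BTerm O X} (h : ∀ (A : Type u) [BooleanAlgebra A] [Ops O A],
    InVariety E A → ∀ v : X → A, s.eval v = t.eval v) : mk E s = mk E t :=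
  Quotient.sound (s := freeSetoid E X) h

theorem ind {p : FreeAlg E X → Prop} (h : ∀ t, p (mk E t)) (x : FreeAlg E X) : p x :=
  Quotient.ind (s := freeSetoid E X) h x

/-- Meet of classes of terms. -/
def inf (x y : FreeAlg E X) : FreeAlg E X :=
  Quotient.map₂ (sa := freeSetoid E X) (sb := freeSetoid E X) (sc := freeSetoid E X) BTerm.inf
    (fun _ _ h _ _ k A _ _ hA v => congrArg₂ (· ⊓ ·) (h A hA v) (k A hA v)) x y

/-- Join of classes of terms. -/
def sup (x y : FreeAlg E X) : FreeAlg E X :=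
  Quotient.map₂ (sa := freeSetoid E X) (sb := freeSetoid E X) (sc := freeSetoid E X) BTerm.sup
    (fun _ _ h _ _ k A _ _ hA v => congrArg₂ (· ⊔ ·) (h A hA v) (k A hA v)) x y

/-- Complement of a class of terms. -/
def compl (x : FreeAlg E X) : FreeAlg E X :=
  Quotient.map (sa := freeSetoid E X) (sb := freeSetoid E X) BTerm.compl
    (fun _ _ h A _ _ hA v => congrArg (·ᶜ) (h A hA v)) x

instance : Lattice (FreeAlg E X) :=
  letI : Max (FreeAlg E X) := ⟨sup⟩
  letI : Min (FreeAlg E X) := ⟨inf⟩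
  Lattice.mk'
    (fun a b => by
      induction a using ind; induction b using ind
      exact sound fun A _ _ _ v => sup_comm _ _)
    (fun a b c => by
      induction a using ind; induction b using ind; induction c using ind
      exact sound fun A _ _ _ v => sup_assoc _ _ _)
    (fun a b => by
      induction a using ind; induction b using ind
      exact sound fun A _ _ _ v => inf_comm _ _)
    (fun a b c => by
      induction a using ind; induction b using ind; induction c using ind
      exact sound fun A _ _ _ v => inf_assoc _ _ _)
    (fun a b => by
      induction a using ind; induction b using ind
      exact sound fun A _ _ _ v => sup_inf_self)
    (fun a b => by
      induction a using ind; induction b using ind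
      exact sound fun A _ _ _ v => inf_sup_self)

instance : DistribLattice (FreeAlg E X) where
  le_sup_inf a b c := by
    refine le_of_eq ?_
    induction a using ind; induction b using ind; induction c using ind
    exact sound fun A _ _ _ v => (sup_inf_left _ _ _).symm

instance : BooleanAlgebra (FreeAlg E X) where
  compl := compl
  bot := mk E .bot
  top := mk E .top
  le_top a := by
    refine inf_eq_left.mp ?_
    induction a using ind
    exact sound fun A _ _ _ v => inf_top_eq _
  bot_le a := by
    refine inf_eq_left.mp ?_
    induction a using ind
    exact sound fun A _ _ _ v => bot_inf_eq _
  inf_compl_le_bot a := by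
    refine le_of_eq ?_
    induction a using ind
    exact sound fun A _ _ _ v => inf_compl_self _
  top_le_sup_compl a := by
    refine le_of_eq ?_
    induction a using ind
    exact sound fun A _ _ _ v => (sup_compl_eq_top).symm

/-- The operation symbols act on representatives (the choice of which does not matter). -/
noncomputable instance : Ops O (FreeAlg E X) where
  op f v := mk E (.app f fun i => Quotient.out (s := freeSetoid E X) (v i))

end FreeAlg

/-! ### Coherence -/

/-- `A` is finitely generated. -/
def FinitelyGenerated (O : ℕ → Type u) (A : Type u) [BooleanAlgebra A] [Ops O A] : Prop :=
  ∃ (n : ℕ) (a : Fin n → A), ∀ x : A, ∃ t : BTerm O (Fin n), t.eval a = x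

/-- `A` is a finitely presented member of the variety: it is isomorphic to the quotient of a
finitely generated free algebra by a finitely generated (compact) congruence, that is, there is a
surjective homomorphism onto `A` whose kernel is such a congruence. -/
def FinitelyPresented {O : ℕ → Type u} (E : Set (BTerm O ℕ × BTerm O ℕ))
    (A : Type u) [BooleanAlgebra A] [Ops O A] : Prop :=
  InVariety E A ∧ ∃ (n : ℕ) (S : Set (FreeAlg E (Fin n) × FreeAlg E (Fin n)))
    (h : OpHom O (FreeAlg E (Fin n)) A), S.Finite ∧ Function.Surjective h.toFun ∧
      ∀ x y, h.toFun x = h.toFun y ↔ Cg O S x y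

/-- The variety is coherent: finitely generated subalgebras of finitely presented members are
finitely presented. Subalgebras are given, up to isomorphism, by injective homomorphisms. -/
def Coherent {O : ℕ → Type u} (E : Set (BTerm O ℕ × BTerm O ℕ)) : Prop :=
  ∀ (B : Type u) [BooleanAlgebra B] [Ops O B], FinitelyPresented E B →
    ∀ (A : Type u) [BooleanAlgebra A] [Ops O A] (j : OpHom O A B), Function.Injective j.toFun →
      FinitelyGenerated O A → FinitelyPresented E A

/-! ### Canonical extensions -/

section Canonical

variable {A C : Type u} [BooleanAlgebra A] [CompleteBooleanAlgebra C]

/-- Closed elements: meets of subsets of the image of `A`. -/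
def IsClosedElt (e : BoundedLatticeHom A C) (c : C) : Prop :=
  ∃ S : Set A, c = sInf (e '' S)

/-- Open elements: joins of subsets of the image of `A`. -/
def IsOpenElt (e : BoundedLatticeHom A C) (c : C) : Prop :=
  ∃ S : Set A, c = sSup (e '' S)

/-- `C` with the embedding `e` is a canonical extension of the Boolean algebra `A`: a dense and
compact completion. (For an embedding of the Boolean algebra `A` in a complete lattice, preserving
all finite meets and joins means being a bounded lattice homomorphism; the canonical extension of
a Boolean algebra is a Boolean algebra.) -/
structure IsCanonicalExtension (e : BoundedLatticeHom A C) : Prop where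
  injective : Function.Injective e
  dense_closed : ∀ x : C, ∃ S : Set C, (∀ c ∈ S, IsClosedElt e c) ∧ x = sSup S
  dense_open : ∀ x : C, ∃ S : Set C, (∀ c ∈ S, IsOpenElt e c) ∧ x = sInf S
  compact : ∀ S T : Set C, (∀ c ∈ S, IsClosedElt e c) → (∀ c ∈ T, IsOpenElt e c) →
    sInf S ≤ sSup T →
    ∃ S₀ ⊆ S, ∃ T₀ ⊆ T, S₀.Finite ∧ T₀.Finite ∧ sInf S₀ ≤ sSup T₀

/-- The `σ`-extension of an `n`-ary map, computed coordinatewise: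
`f^σ(x) = ⋁ {⋀ {f(a) | a ∈ Aⁿ, p ≤ a ≤ q} | p closed, q open, p ≤ x ≤ q}`. -/
def sigmaExt (e : BoundedLatticeHom A C) {n : ℕ} (f : (Fin n → A) → A) (x : Fin n → C) : C :=
  sSup {y | ∃ p q : Fin n → C, (∀ i, IsClosedElt e (p i)) ∧ (∀ i, IsOpenElt e (q i)) ∧
    p ≤ x ∧ x ≤ q ∧
    y = sInf {z | ∃ a : Fin n → A, (∀ i, p i ≤ e (a i) ∧ e (a i) ≤ q i) ∧ z = e (f a)}}

/-- The `π`-extension of an `n`-ary map, computed coordinatewise: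
`f^π(x) = ⋀ {⋁ {f(a) | a ∈ Aⁿ, p ≤ a ≤ q} | p closed, q open, p ≤ x ≤ q}`. -/
def piExt (e : BoundedLatticeHom A C) {n : ℕ} (f : (Fin n → A) → A) (x : Fin n → C) : C :=
  sInf {y | ∃ p q : Fin n → C, (∀ i, IsClosedElt e (p i)) ∧ (∀ i, IsOpenElt e (q i)) ∧
    p ≤ x ∧ x ≤ q ∧
    y = sSup {z | ∃ a : Fin n → A, (∀ i, p i ≤ e (a i) ∧ e (a i) ≤ q i) ∧ z = e (f a)}}

/-- The two ways of extending an operation. -/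
inductive ExtKind where
  | sigma
  | pi

/-- The `σ`- or `π`-extension. -/
def kindExt (k : ExtKind) (e : BoundedLatticeHom A C) {n : ℕ} (f : (Fin n → A) → A)
    (x : Fin n → C) : C :=
  match k with
  | .sigma => sigmaExt e f x
  | .pi => piExt e f x

/-- The algebra `C` is, via `e`, the canonical extension of the algebra `A`, where each operation
symbol is extended in the way prescribed by `κ`. (For the Boolean operations both ways agree and
give the Boolean operations of `C`.) -/
def IsCanonicalExtensionAlg {O : ℕ → Type u} (κ : ∀ n : ℕ, O n → ExtKind) [Ops O A] [Ops O C]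
    (e : BoundedLatticeHom A C) : Prop :=
  IsCanonicalExtension e ∧ ∀ (n : ℕ) (f : O n) (x : Fin n → C),
    Ops.op f x = kindExt (κ n f) e (Ops.op f : (Fin n → A) → A) x

end Canonical

/-- The variety is closed under canonical extensions. -/
def ClosedUnderCanonicalExtensions {O : ℕ → Type u} (κ : ∀ n : ℕ, O n → ExtKind)
    (E : Set (BTerm O ℕ × BTerm O ℕ)) : Prop :=
  ∀ (A : Type u) [BooleanAlgebra A] [Ops O A] (C : Type u) [CompleteBooleanAlgebra C] [Ops O C]
    (e : BoundedLatticeHom A C), InVariety E A → IsCanonicalExtensionAlg κ e → InVariety E C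

/-- The term `t` is expanding in the variety: `(t^A)^σ ≤ t^(A^σ)` for every member `A`. -/
def IsExpanding {O : ℕ → Type u} (κ : ∀ n : ℕ, O n → ExtKind) (E : Set (BTerm O ℕ × BTerm O ℕ))
    {n : ℕ} (t : BTerm O (Fin n)) : Prop :=
  ∀ (A : Type u) [BooleanAlgebra A] [Ops O A] (C : Type u) [CompleteBooleanAlgebra C] [Ops O C]
    (e : BoundedLatticeHom A C), InVariety E A → IsCanonicalExtensionAlg κ e →
    ∀ x : Fin n → C, sigmaExt e (fun a : Fin n → A => t.eval a) x ≤ t.eval x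

/-- The term `t` interprets in every member of the variety as a (multiplicative) operator. -/
def IsOperatorTerm {O : ℕ → Type u} (E : Set (BTerm O ℕ × BTerm O ℕ))
    {n : ℕ} (t : BTerm O (Fin n)) : Prop :=
  ∀ (A : Type u) [BooleanAlgebra A] [Ops O A], InVariety E A →
    IsOperator (fun a : Fin n → A => t.eval a)

/-! ### Term-reducts -/

/-- The signature whose operation symbols are the terms in `T`. -/
def termSig {O : ℕ → Type u} (T : Set (Σ n : ℕ, BTerm O (Fin n))) : ℕ → Type u :=
  fun n => {t : BTerm O (Fin n) // (⟨n, t⟩ : Σ n : ℕ, BTerm O (Fin n)) ∈ T}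

/-- The term-reduct of `A` in the signature `T`: each term is interpreted as its term operation
(and the Boolean operations are kept). -/
@[reducible] def reduct {O : ℕ → Type u} (T : Set (Σ n : ℕ, BTerm O (Fin n)))
    (A : Type u) [BooleanAlgebra A] [Ops O A] : Ops (termSig T) A where
  op t v := t.1.eval v

/-- The equations that hold in the `T`-term-reducts of all members of the variety axiomatized by
`E`. They axiomatize the variety generated by these reducts. -/
def reductEquations {O : ℕ → Type u} (E : Set (BTerm O ℕ × BTerm O ℕ))
    (T : Set (Σ n : ℕ, BTerm O (Fin n))) : Set (BTerm (termSig T) ℕ × BTerm (termSig T) ℕ) :=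
  {p | ∀ (A : Type u) [BooleanAlgebra A] [Ops O A], InVariety E A → ∀ v : ℕ → A,
    letI : Ops (termSig T) A := reduct T A
    p.1.eval v = p.2.eval v}

end BAO

/-!
For a finite set of operators let `box a` be the meet of `a` and of all `f (⊥, …, a, …, ⊥)`, where
`f` ranges over the operators and `a` over the coordinates. A principal filter is the filter of a
congruence precisely when its generator `u` satisfies `u ≤ box u`. Hence, as soon as the descending
sequence of the iterates `box^k a` stops at the same `K` in all members of a variety, the congruence
generated by `(a, b)` is equality modulo `box^K (a ↔ b)`, which is an equational condition
(`hasEDPC_of_box`). It remains to see that coherence of the variety stops the iterates at some `K`;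
that they stop is expressed by an equation, which passes to the variety generated by the reducts.

In the canonical extension of an algebra of the variety, the meet of all `box^k a` is a fixpoint of
the box (`iInf_iterate_box_le`), by compactness and because the terms are expanding. Therefore every
algebra in which `b ≤ box^k a` for all `k` embeds in a member of the variety that has a fixpoint of
the box between `b` and `a` (`exists_fixpoint_extension`). Consequently, in the finitely presented
algebra given by the relations `z ≤ y ≤ x` and `y ≤ box y`, the subalgebra generated by `x` and `z`
is axiomatized by the relations `z ≤ box^k x`. Coherence makes it finitely presented, so a single
one of these relations, for `k = K`, implies the others, and the choice `z = box^K x` shows that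
`box^K x ≤ box^(K + 1) x` throughout the variety (`exists_iterate_box_le`).

Existence of canonical extensions is proved with the power set of the set of prime ideals.
-/

namespace BAO

/-! ### Terms, homomorphisms and quotients -/

section Terms

variable {O : ℕ → Type u} {X Y : Type} {A B : Type u}
  [BooleanAlgebra A] [Ops O A] [BooleanAlgebra B] [Ops O B]

@[simp]
theorem BTerm.eval_var (v : X → A) (x : X) : (var x : BTerm O X).eval v = v x :=
  rfl

@[simp]
theorem BTerm.eval_top (v : X → A) : (top : BTerm O X).eval v = ⊤ :=
  rfl

@[simp]
theorem BTerm.eval_inf (s t : BTerm O X) (v : X → A) : (inf s t).eval v = s.eval v ⊓ t.eval v :=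
  rfl

/-- Substitution of terms for the variables of a term. -/
def BTerm.subst (σ : X → BTerm O Y) : BTerm O X → BTerm O Y
  | .var x => σ x
  | .bot => .bot
  | .top => .top
  | .inf s t => .inf (s.subst σ) (t.subst σ)
  | .sup s t => .sup (s.subst σ) (t.subst σ)
  | .compl t => .compl (t.subst σ)
  | .app f ts => .app f fun i => (ts i).subst σ

theorem BTerm.eval_subst (σ : X → BTerm O Y) (v : Y → A) (t : BTerm O X) :
    (t.subst σ).eval v = t.eval fun x => (σ x).eval v := by
  induction t with
  | var x => rfl
  | bot => rfl
  | top => rfl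
  | inf s t hs ht => simp only [subst, eval, hs, ht]
  | sup s t hs ht => simp only [subst, eval, hs, ht]
  | compl t ht => simp only [subst, eval, ht]
  | app f ts h => simp only [subst, eval, h]

theorem OpHom.map_inf (h : OpHom O A B) (a b : A) : h.toFun (a ⊓ b) = h.toFun a ⊓ h.toFun b :=
  h.map_inf' a b

theorem OpHom.map_compl (h : OpHom O A B) (a : A) : h.toFun aᶜ = (h.toFun a)ᶜ :=
  map_compl' h.toBoundedLatticeHom a

theorem OpHom.map_eval (h : OpHom O A B) (v : X → A) (t : BTerm O X) :
    h.toFun (t.eval v) = t.eval fun x => h.toFun (v x) := by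
  induction t with
  | var x => rfl
  | bot => exact h.map_bot'
  | top => exact h.map_top'
  | inf s t hs ht => exact (h.map_inf' _ _).trans (congrArg₂ (· ⊓ ·) hs ht)
  | sup s t hs ht => exact (h.map_sup' _ _).trans (congrArg₂ (· ⊔ ·) hs ht)
  | compl t ht => exact (h.map_compl _).trans (congrArg compl ht)
  | app f ts ih => exact (h.map_op f _).trans (congrArg (Ops.op f) (funext ih))

theorem IsCongruence.eval {r : A → A → Prop} (hr : IsCongruence O r) {v w : X → A}
    (h : ∀ x, r (v x) (w x)) (t : BTerm O X) : r (t.eval v) (t.eval w) := by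
  induction t with
  | var x => exact h x
  | bot => exact hr.equiv.refl _
  | top => exact hr.equiv.refl _
  | inf s t hs ht => exact hr.inf hs ht
  | sup s t hs ht => exact hr.sup hs ht
  | compl t ht => exact hr.compl ht
  | app f ts ih => exact hr.op f ih

/-- The preimage of a congruence under a homomorphism is a congruence. -/
theorem IsCongruence.comap {r : B → B → Prop} (hr : IsCongruence O r) (h : OpHom O A B) :
    IsCongruence O fun a b => r (h.toFun a) (h.toFun b) where
  equiv := hr.equiv.comap h.toFun
  inf hab hcd := by
    have := hr.inf hab hcd
    rwa [← h.map_inf', ← h.map_inf'] at this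
  sup hab hcd := by
    have := hr.sup hab hcd
    rwa [← h.map_sup', ← h.map_sup'] at this
  compl hab := by
    have := hr.compl hab
    rwa [← h.map_compl, ← h.map_compl] at this
  op f v w hvw := by
    have := hr.op f hvw
    rwa [← h.map_op, ← h.map_op] at this

theorem isCongruence_eq : IsCongruence O (fun a b : A => a = b) where
  equiv := eq_equivalence
  inf h k := congrArg₂ _ h k
  sup h k := congrArg₂ _ h k
  compl h := congrArg _ h
  op _ _ _ h := congrArg _ (funext h)

theorem OpHom.isCongruence_ker (h : OpHom O A B) :
    IsCongruence O fun a b => h.toFun a = h.toFun b :=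
  isCongruence_eq.comap h

theorem isCongruence_cg (S : Set (A × A)) : IsCongruence O (Cg O S) where
  equiv :=
    { refl := fun _ _ hr _ => hr.equiv.refl _
      symm := fun h r hr hS => hr.equiv.symm (h r hr hS)
      trans := fun h k r hr hS => hr.equiv.trans (h r hr hS) (k r hr hS) }
  inf h k r hr hS := hr.inf (h r hr hS) (k r hr hS)
  sup h k r hr hS := hr.sup (h r hr hS) (k r hr hS)
  compl h r hr hS := hr.compl (h r hr hS)
  op f _ _ h r hr hS := hr.op f fun i => h i r hr hS

theorem cg_of_mem {S : Set (A × A)} {p : A × A} (hp : p ∈ S) : Cg O S p.1 p.2 :=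
  fun _ _ hS => hS p hp

/-- The union of an ascending chain of congruences is a congruence, because all operations are
finitary. -/
theorem isCongruence_iUnion {r : ℕ → A → A → Prop} (hr : ∀ k, IsCongruence O (r k))
    (hmono : ∀ {k l : ℕ}, k ≤ l → ∀ {a b : A}, r k a b → r l a b) :
    IsCongruence O fun a b => ∃ k, r k a b where
  equiv :=
    { refl := fun a => ⟨0, (hr 0).equiv.refl a⟩
      symm := fun ⟨k, h⟩ => ⟨k, (hr k).equiv.symm h⟩
      trans := fun ⟨k, h⟩ ⟨l, h'⟩ => ⟨max k l, (hr _).equiv.trans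
        (hmono (le_max_left k l) h) (hmono (le_max_right k l) h')⟩ }
  inf := fun ⟨k, h⟩ ⟨l, h'⟩ => ⟨max k l, (hr _).inf
    (hmono (le_max_left k l) h) (hmono (le_max_right k l) h')⟩
  sup := fun ⟨k, h⟩ ⟨l, h'⟩ => ⟨max k l, (hr _).sup
    (hmono (le_max_left k l) h) (hmono (le_max_right k l) h')⟩
  compl := fun ⟨k, h⟩ => ⟨k, (hr k).compl h⟩
  op f v w h := by
    choose k hk using h
    exact ⟨Finset.univ.sup k, (hr _).op f fun i => hmono (Finset.le_sup (Finset.mem_univ i)) (hk i)⟩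

end Terms

/-- The quotient of an algebra by a congruence. -/
def QuotAlg {O : ℕ → Type u} {A : Type u} [BooleanAlgebra A] [Ops O A] {r : A → A → Prop}
    (hr : IsCongruence O r) : Type u :=
  Quotient (⟨r, hr.equiv⟩ : Setoid A)

namespace QuotAlg

variable {O : ℕ → Type u} {A D : Type u} [BooleanAlgebra A] [Ops O A] [BooleanAlgebra D] [Ops O D]
  {r : A → A → Prop} {hr : IsCongruence O r}

/-- The class of an element. -/
def mk (hr : IsCongruence O r) (a : A) : QuotAlg hr :=
  Quotient.mk ⟨r, hr.equiv⟩ a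

theorem mk_eq {a b : A} : mk hr a = mk hr b ↔ r a b :=
  Quotient.eq (r := ⟨r, hr.equiv⟩)

theorem ind {p : QuotAlg hr → Prop} (h : ∀ a, p (mk hr a)) (x : QuotAlg hr) : p x :=
  Quotient.ind (s := ⟨r, hr.equiv⟩) h x

theorem mk_surjective : Function.Surjective (mk hr) :=
  ind fun a => ⟨a, rfl⟩

instance : Lattice (QuotAlg hr) :=
  letI : Max (QuotAlg hr) := ⟨Quotient.map₂ (sa := ⟨r, hr.equiv⟩) (sb := ⟨r, hr.equiv⟩)
    (sc := ⟨r, hr.equiv⟩) (· ⊔ ·) fun _ _ h _ _ k => hr.sup h k⟩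
  letI : Min (QuotAlg hr) := ⟨Quotient.map₂ (sa := ⟨r, hr.equiv⟩) (sb := ⟨r, hr.equiv⟩)
    (sc := ⟨r, hr.equiv⟩) (· ⊓ ·) fun _ _ h _ _ k => hr.inf h k⟩
  Lattice.mk'
    (fun a b => by
      induction a using ind; induction b using ind
      exact congrArg (mk hr) (sup_comm _ _))
    (fun a b c => by
      induction a using ind; induction b using ind; induction c using ind
      exact congrArg (mk hr) (sup_assoc _ _ _))
    (fun a b => by
      induction a using ind; induction b using ind
      exact congrArg (mk hr) (inf_comm _ _))
    (fun a b c => by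
      induction a using ind; induction b using ind; induction c using ind
      exact congrArg (mk hr) (inf_assoc _ _ _))
    (fun a b => by
      induction a using ind; induction b using ind
      exact congrArg (mk hr) sup_inf_self)
    (fun a b => by
      induction a using ind; induction b using ind
      exact congrArg (mk hr) inf_sup_self)

instance : DistribLattice (QuotAlg hr) where
  le_sup_inf a b c := by
    refine le_of_eq ?_
    induction a using ind; induction b using ind; induction c using ind
    exact congrArg (mk hr) (sup_inf_left _ _ _).symm

instance : BooleanAlgebra (QuotAlg hr) where
  compl := Quotient.map (sa := ⟨r, hr.equiv⟩) (sb := ⟨r, hr.equiv⟩) (·ᶜ) fun _ _ h => hr.compl h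
  bot := mk hr ⊥
  top := mk hr ⊤
  le_top a := by
    refine inf_eq_left.mp ?_
    induction a using ind
    exact congrArg (mk hr) (inf_top_eq _)
  bot_le a := by
    refine inf_eq_left.mp ?_
    induction a using ind
    exact congrArg (mk hr) (bot_inf_eq _)
  inf_compl_le_bot a := by
    refine le_of_eq ?_
    induction a using ind
    exact congrArg (mk hr) (inf_compl_self _)
  top_le_sup_compl a := by
    refine le_of_eq ?_
    induction a using ind
    exact congrArg (mk hr) sup_compl_eq_top.symm

noncomputable instance : Ops O (QuotAlg hr) where
  op f v := mk hr (Ops.op f fun i => Quotient.out (s := ⟨r, hr.equiv⟩) (v i))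

/-- The quotient homomorphism. -/
def proj (hr : IsCongruence O r) : OpHom O A (QuotAlg hr) where
  toFun := mk hr
  map_sup' _ _ := rfl
  map_inf' _ _ := rfl
  map_top' := rfl
  map_bot' := rfl
  map_op f v := mk_eq.mpr <| hr.op f fun i =>
    mk_eq.mp (Quotient.out_eq (s := ⟨r, hr.equiv⟩) (mk hr (v i))).symm

/-- A homomorphism whose kernel contains the congruence factors through the quotient. -/
def lift (hr : IsCongruence O r) (h : OpHom O A D) (hh : ∀ a b, r a b → h.toFun a = h.toFun b) :
    OpHom O (QuotAlg hr) D where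
  toFun := Quotient.lift (s := ⟨r, hr.equiv⟩) h.toFun hh
  map_sup' x y := by
    induction x using ind; induction y using ind
    exact h.map_sup' _ _
  map_inf' x y := by
    induction x using ind; induction y using ind
    exact h.map_inf' _ _
  map_top' := h.map_top'
  map_bot' := h.map_bot'
  map_op {n} f v := by
    obtain ⟨w, rfl⟩ : ∃ w : Fin n → A, v = fun i => mk hr (w i) := by
      choose w hw using fun i => mk_surjective (v i)
      exact ⟨w, funext fun i => (hw i).symm⟩
    rw [← (show (proj hr).toFun = mk hr from rfl), ← (proj hr).map_op]
    exact h.map_op f w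

theorem inVariety (hr : IsCongruence O r) {E : Set (BTerm O ℕ × BTerm O ℕ)} (hA : InVariety E A) :
    InVariety E (QuotAlg hr) := by
  intro e he v
  obtain ⟨w, rfl⟩ : ∃ w : ℕ → A, v = fun i => (proj hr).toFun (w i) := by
    choose w hw using fun i => mk_surjective (v i)
    exact ⟨w, funext fun i => (hw i).symm⟩
  rw [← (proj hr).map_eval, ← (proj hr).map_eval, hA e he w]

end QuotAlg

/-! ### The universal property of free algebras -/

namespace FreeAlg

variable {O : ℕ → Type u} {E : Set (BTerm O ℕ × BTerm O ℕ)} {X : Type} {D : Type u}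
  [BooleanAlgebra D] [Ops O D]

theorem mk_app {n : ℕ} (f : O n) (ts : Fin n → BTerm O X) :
    mk E (.app f ts) = Ops.op f fun i => mk E (ts i) :=
  sound fun A _ _ hA v => congrArg (Ops.op f) <| funext fun i =>
    (Quotient.exact (s := freeSetoid E X) (Quotient.out_eq (s := freeSetoid E X) (mk E (ts i))) A
      hA v).symm

/-- The free generators. -/
def gen (E : Set (BTerm O ℕ × BTerm O ℕ)) (x : X) : FreeAlg E X :=
  mk E (.var x)

theorem eval_mk {Y : Type} (t : BTerm O Y) (σ : Y → BTerm O X) :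
    (t.eval fun y => mk E (σ y)) = mk E (t.subst σ) := by
  induction t with
  | var x => rfl
  | bot => rfl
  | top => rfl
  | inf s t hs ht => rw [BTerm.eval, hs, ht]; rfl
  | sup s t hs ht => rw [BTerm.eval, hs, ht]; rfl
  | compl t ht => rw [BTerm.eval, ht]; rfl
  | app f ts h => rw [BTerm.eval, BTerm.subst, mk_app]; exact congrArg _ (funext h)

theorem eval_gen (t : BTerm O X) : t.eval (gen E) = mk E t :=
  (eval_mk t _).trans <| sound fun _ _ _ _ v => BTerm.eval_subst _ v t

theorem inVariety : InVariety E (FreeAlg E X) := by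
  intro e he v
  obtain ⟨σ, rfl⟩ : ∃ σ : ℕ → BTerm O X, v = fun i => mk E (σ i) := by
    choose σ hσ using fun i => Quotient.exists_rep (s := freeSetoid E X) (v i)
    exact ⟨σ, funext fun i => (hσ i).symm⟩
  rw [eval_mk, eval_mk]
  refine sound fun A _ _ hA w => ?_
  rw [BTerm.eval_subst, BTerm.eval_subst, hA e he]

/-- The homomorphism that extends an assignment of the generators in a member of the variety. -/
def lift (hD : InVariety E D) (v : X → D) : OpHom O (FreeAlg E X) D where
  toFun := Quotient.lift (s := freeSetoid E X) (BTerm.eval v) fun _ _ h => h D hD v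
  map_sup' x y := by
    induction x using ind; induction y using ind
    rfl
  map_inf' x y := by
    induction x using ind; induction y using ind
    rfl
  map_top' := rfl
  map_bot' := rfl
  map_op {n} f w := by
    obtain ⟨σ, rfl⟩ : ∃ σ : Fin n → BTerm O X, w = fun i => mk E (σ i) := by
      choose σ hσ using fun i => Quotient.exists_rep (s := freeSetoid E X) (w i)
      exact ⟨σ, funext fun i => (hσ i).symm⟩
    rw [← mk_app]
    rfl

theorem hom_ext (g h : OpHom O (FreeAlg E X) D) (H : ∀ x, g.toFun (gen E x) = h.toFun (gen E x))
    (a : FreeAlg E X) : g.toFun a = h.toFun a := by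
  induction a using ind with
  | h t => rw [← eval_gen, g.map_eval, h.map_eval, funext H]

end FreeAlg

/-- The composite of two homomorphisms. -/
def OpHom.comp {O : ℕ → Type u} {A B C : Type u} [BooleanAlgebra A] [Ops O A] [BooleanAlgebra B]
    [Ops O B] [BooleanAlgebra C] [Ops O C] (g : OpHom O B C) (h : OpHom O A B) : OpHom O A C where
  toBoundedLatticeHom := g.toBoundedLatticeHom.comp h.toBoundedLatticeHom
  map_op f v := (congrArg g.toFun (h.map_op f v)).trans (g.map_op f _)

/-! ### Existence of canonical extensions -/

open Order

/-- The carrier of the canonical extension of `A`: the power set of the set of prime ideals. -/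
abbrev CanExt (A : Type u) [BooleanAlgebra A] : Type u :=
  Set {I : Ideal A // I.IsPrime}

namespace CanExt

variable {A : Type u} [BooleanAlgebra A]

/-- The Stone embedding: `a` is sent to the set of all prime ideals that do not contain `a`. -/
def emb (A : Type u) [BooleanAlgebra A] : BoundedLatticeHom A (CanExt A) where
  toFun a := {I : {I : Ideal A // I.IsPrime} | a ∉ I.1}
  map_sup' a b := by
    refine Set.ext fun I => ?_
    change a ⊔ b ∉ I.1 ↔ a ∉ I.1 ∨ b ∉ I.1
    rw [Ideal.sup_mem_iff]
    tauto
  map_inf' a b := by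
    refine Set.ext fun I => ?_
    change a ⊓ b ∉ I.1 ↔ a ∉ I.1 ∧ b ∉ I.1
    have h1 : a ⊓ b ∈ I.1 → a ∈ I.1 ∨ b ∈ I.1 := I.2.mem_or_mem
    have h2 : a ∈ I.1 → a ⊓ b ∈ I.1 := I.1.lower inf_le_left
    have h3 : b ∈ I.1 → a ⊓ b ∈ I.1 := I.1.lower inf_le_right
    tauto
  map_top' := Set.eq_univ_of_forall fun I => I.2.toIsProper.top_notMem
  map_bot' := Set.eq_empty_of_forall_notMem fun I hI => hI I.1.bot_mem

theorem mem_emb {a : A} {I : {I : Ideal A // I.IsPrime}} :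
    I ∈ (emb A a) ↔ a ∉ I.1 :=
  Iff.rfl

theorem le_of_emb_le {a b : A} (h : emb A a ≤ emb A b) : a ≤ b := by
  by_contra hab
  have hdisj : Disjoint (PFilter.principal a : Set A) (Ideal.principal b : Set A) :=
    Set.disjoint_left.mpr fun x hx hx' => hab (le_trans hx hx')
  obtain ⟨J, hJ, hbJ, haJ⟩ := DistribLattice.prime_ideal_of_disjoint_filter_ideal hdisj
  have ha : a ∉ J := Set.disjoint_left.mp haJ (le_refl a : a ∈ PFilter.principal a)
  have hb : b ∈ J := hbJ (le_refl b : b ∈ Ideal.principal b)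
  exact mem_emb.mp (h (mem_emb.mpr ha : (⟨J, hJ⟩ : {I : Ideal A // I.IsPrime}) ∈ _)) hb

theorem isCanonicalExtension (A : Type u) [BooleanAlgebra A] : IsCanonicalExtension (emb A) where
  injective a b h := le_antisymm (le_of_emb_le h.le) (le_of_emb_le h.ge)
  dense_closed x := by
    -- A prime ideal `I` is the only point of the meet of all `emb A a` with `a ∉ I`.
    refine ⟨{c | ∃ I ∈ x, c = sInf (emb A '' {a | a ∉ I.1})},
      fun c ⟨I, _, hc⟩ => ⟨_, hc⟩, le_antisymm ?_ (sSup_le ?_)⟩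
    · intro I hI
      refine Set.mem_sUnion.mpr ⟨_, ⟨I, hI, rfl⟩, Set.mem_sInter.mpr ?_⟩
      rintro _ ⟨a, ha, rfl⟩
      exact ha
    · rintro _ ⟨I, hI, rfl⟩ J hJ
      have hJ' : ∀ a, a ∉ I.1 → a ∉ J.1 := fun a ha => Set.mem_sInter.mp hJ _ ⟨a, ha, rfl⟩
      have : J = I := by
        refine Subtype.ext (SetLike.ext fun a => ⟨fun h => by_contra fun h' => hJ' a h' h,
          fun h => by_contra fun h' => ?_⟩)
        refine hJ' aᶜ (fun hc => I.2.toIsProper.top_notMem ?_) (J.2.compl_mem_of_notMem h')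
        rw [← sup_compl_eq_top (x := a)]
        exact Ideal.sup_mem h hc
      exact this ▸ hI
  dense_open x := by
    -- The complement of a prime ideal `I` is the join of all `emb A a` with `a ∈ I`.
    refine ⟨{c | ∃ I ∉ x, c = sSup (emb A '' {a | a ∈ I.1})},
      fun c ⟨I, _, hc⟩ => ⟨_, hc⟩, le_antisymm (le_sInf ?_) ?_⟩
    · rintro _ ⟨I, hI, rfl⟩ J hJ
      by_contra hcon
      have hJ' : ∀ a, a ∈ I.1 → a ∈ J.1 := fun a ha => by_contra fun h =>
        hcon (Set.mem_sUnion.mpr ⟨_, ⟨a, ha, rfl⟩, h⟩)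
      have : J = I := by
        refine Subtype.ext (SetLike.ext fun a => ⟨fun h => by_contra fun h' => ?_, hJ' a⟩)
        refine J.2.toIsProper.top_notMem ?_
        rw [← sup_compl_eq_top (x := a)]
        exact Ideal.sup_mem h (hJ' _ (I.2.compl_mem_of_notMem h'))
      exact hI (this ▸ hJ)
    · intro I hI
      by_contra hx
      obtain ⟨_, ⟨a, ha, rfl⟩, h⟩ := Set.mem_sUnion.mp (Set.mem_sInter.mp hI _ ⟨I, hx, rfl⟩)
      exact h ha
  compact S T hS hT hST := by
    -- Were there no finite subcover, some prime ideal would contain the ideal of all `b` below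
    -- finite joins from `T` and avoid the filter of all `a` above finite meets from `S`.
    have hF : IsPFilter {a : A | ∃ S₀ ⊆ S, S₀.Finite ∧ sInf S₀ ≤ emb A a} := by
      refine IsPFilter.of_def ⟨⊤, ∅, Set.empty_subset _, Set.finite_empty, ?_⟩ ?_ ?_
      · rw [map_top]
        exact le_top
      · rintro a ⟨S₁, h₁, f₁, i₁⟩ b ⟨S₂, h₂, f₂, i₂⟩
        refine ⟨a ⊓ b, ⟨S₁ ∪ S₂, Set.union_subset h₁ h₂, f₁.union f₂, ?_⟩, inf_le_left,
          inf_le_right⟩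
        rw [sInf_union, map_inf]
        exact inf_le_inf i₁ i₂
      · rintro a b hab ⟨S₁, h₁, f₁, i₁⟩
        exact ⟨S₁, h₁, f₁, i₁.trans (OrderHomClass.mono (emb A) hab)⟩
    have hI : IsIdeal {b : A | ∃ T₀ ⊆ T, T₀.Finite ∧ emb A b ≤ sSup T₀} := by
      refine ⟨?_, ⟨⊥, ∅, Set.empty_subset _, Set.finite_empty, ?_⟩, ?_⟩
      · rintro a b hab ⟨T₁, h₁, f₁, i₁⟩
        exact ⟨T₁, h₁, f₁, (OrderHomClass.mono (emb A) hab).trans i₁⟩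
      · rw [map_bot]
        exact bot_le
      · rintro a ⟨S₁, h₁, f₁, i₁⟩ b ⟨S₂, h₂, f₂, i₂⟩
        refine ⟨a ⊔ b, ⟨S₁ ∪ S₂, Set.union_subset h₁ h₂, f₁.union f₂, ?_⟩, le_sup_left,
          le_sup_right⟩
        rw [sSup_union, map_sup]
        exact sup_le_sup i₁ i₂
    by_cases hdisj : Disjoint (hF.toPFilter : Set A) (hI.toIdeal : Set A)
    · obtain ⟨J, hJ, hIJ, hFJ⟩ := DistribLattice.prime_ideal_of_disjoint_filter_ideal hdisj
      have hJS : (⟨J, hJ⟩ : {I : Ideal A // I.IsPrime}) ∈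
          (sInf S : Set {I : Ideal A // I.IsPrime}) := by
        refine Set.mem_sInter.mpr fun c hc => ?_
        obtain ⟨U, rfl⟩ := hS c hc
        refine Set.mem_sInter.mpr ?_
        rintro _ ⟨a, ha, rfl⟩
        refine Set.disjoint_left.mp hFJ (show a ∈ {a : A | _} from ?_)
        refine ⟨{_}, Set.singleton_subset_iff.mpr hc, Set.finite_singleton _, ?_⟩
        rw [sInf_singleton]
        exact sInf_le ⟨a, ha, rfl⟩
      obtain ⟨d, hd, hJd⟩ := Set.mem_sUnion.mp (hST hJS)
      obtain ⟨U, rfl⟩ := hT d hd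
      obtain ⟨_, ⟨a, ha, rfl⟩, hJa⟩ := Set.mem_sUnion.mp hJd
      refine absurd (hIJ (show a ∈ {a : A | _} from ?_)) hJa
      refine ⟨{_}, Set.singleton_subset_iff.mpr hd, Set.finite_singleton _, ?_⟩
      rw [sSup_singleton]
      exact le_sSup ⟨a, ha, rfl⟩
    · obtain ⟨a, ⟨S₀, hS₀, fS, iS⟩, ⟨T₀, hT₀, fT, iT⟩⟩ := Set.not_disjoint_iff.mp hdisj
      exact ⟨S₀, hS₀, T₀, hT₀, fS, fT, iS.trans iT⟩

end CanExt

section Ext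

variable {A C : Type u} [BooleanAlgebra A] [CompleteBooleanAlgebra C]

theorem isClosedElt_apply (e : BoundedLatticeHom A C) (a : A) : IsClosedElt e (e a) :=
  ⟨{a}, by rw [Set.image_singleton, sInf_singleton]⟩

theorem isOpenElt_apply (e : BoundedLatticeHom A C) (a : A) : IsOpenElt e (e a) :=
  ⟨{a}, by rw [Set.image_singleton, sSup_singleton]⟩

theorem kindExt_apply (k : ExtKind) {e : BoundedLatticeHom A C} (he : Function.Injective e)
    {n : ℕ} (f : (Fin n → A) → A) (a : Fin n → A) :
    kindExt k e f (fun i => e (a i)) = e (f a) := by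
  have heq : ∀ b : Fin n → A, (∀ i, e (a i) ≤ e (b i) ∧ e (b i) ≤ e (a i)) → b = a :=
    fun b hb => funext fun i => he (le_antisymm (hb i).2 (hb i).1)
  cases k with
  | sigma =>
    refine le_antisymm (sSup_le ?_) (le_sSup_of_le ⟨fun i => e (a i), fun i => e (a i),
      fun i => isClosedElt_apply e _, fun i => isOpenElt_apply e _, le_rfl, le_rfl, rfl⟩ ?_)
    · rintro _ ⟨p, q, -, -, hp, hq, rfl⟩
      exact sInf_le ⟨a, fun i => ⟨hp i, hq i⟩, rfl⟩
    · refine le_sInf ?_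
      rintro _ ⟨b, hb, rfl⟩
      rw [heq b hb]
  | pi =>
    refine le_antisymm (sInf_le_of_le ⟨fun i => e (a i), fun i => e (a i),
      fun i => isClosedElt_apply e _, fun i => isOpenElt_apply e _, le_rfl, le_rfl, rfl⟩ ?_)
      (le_sInf ?_)
    · refine sSup_le ?_
      rintro _ ⟨b, hb, rfl⟩
      rw [heq b hb]
    · rintro _ ⟨p, q, -, -, hp, hq, rfl⟩
      exact le_sSup ⟨a, fun i => ⟨hp i, hq i⟩, rfl⟩

/-- The embedding of an algebra into its canonical extension is a homomorphism. -/
def IsCanonicalExtensionAlg.toOpHom {O : ℕ → Type u} {κ : ∀ n : ℕ, O n → ExtKind} [Ops O A]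
    [Ops O C] {e : BoundedLatticeHom A C} (he : IsCanonicalExtensionAlg κ e) : OpHom O A C where
  toBoundedLatticeHom := e
  map_op f v := ((he.2 _ f _).trans (kindExt_apply _ he.1.injective _ v)).symm

/-- A descending sequence of elements of `A` whose meet lies below `e b` is eventually below
`b`. -/
theorem IsCanonicalExtension.exists_le_of_iInf_le {e : BoundedLatticeHom A C}
    (he : IsCanonicalExtension e) {a : ℕ → A} (ha : Antitone a) {b : A}
    (h : ⨅ k, e (a k) ≤ e b) : ∃ k, a k ≤ b := by
  obtain ⟨S, hS, T, hT, fS, -, hST⟩ := he.compact (Set.range fun k => e (a k)) {e b}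
    (by rintro _ ⟨k, rfl⟩; exact isClosedElt_apply e _)
    (by rintro _ rfl; exact isOpenElt_apply e _) (by rwa [sSup_singleton])
  have hS' : ∀ s ∈ S, ∃ k, e (a k) = s := hS
  choose! idx hidx using hS'
  obtain ⟨K, hK⟩ := (fS.image idx).bddAbove
  have hle : e (a K) ≤ e b := calc
    e (a K) ≤ sInf S := le_sInf fun s hs => by
      rw [← hidx s hs]
      exact OrderHomClass.mono e (ha (hK ⟨s, hs, rfl⟩))
    _ ≤ sSup T := hST
    _ ≤ e b := sSup_le fun t ht => (hT ht : t = e b).le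
  refine ⟨K, inf_eq_left.mp (he.injective ?_)⟩
  rw [map_inf, inf_eq_left.mpr hle]

end Ext

/-! ### Multiplicative operators and the induced box -/

section Operators

variable {A : Type u} [BooleanAlgebra A] {n : ℕ} {f : (Fin n → A) → A}

theorem IsOperator.update_mono (hf : IsOperator f) (v : Fin n → A) (i : Fin n) {x y : A}
    (h : x ≤ y) : f (Function.update v i x) ≤ f (Function.update v i y) := by
  rw [← inf_eq_left.mpr h, (hf i v).1]
  exact inf_le_right

theorem IsOperator.monotone (hf : IsOperator f) : Monotone f := by
  intro v w hvw
  have key : ∀ s : Finset (Fin n), f v ≤ f (s.piecewise w v) := by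
    intro s
    induction s using Finset.induction_on with
    | empty => rw [Finset.piecewise_empty]
    | insert j s hj ih =>
      refine ih.trans ?_
      rw [Finset.piecewise_insert]
      have h := hf.update_mono (s.piecewise w v) j (hvw j)
      rwa [← s.piecewise_eq_of_notMem w v hj, Function.update_eq_self] at h
  simpa using key Finset.univ

/-- An element `u` that lies below `f (⊥, …, u, …, ⊥)` for every coordinate may be met with all
arguments of `f` at once. -/
theorem IsOperator.inf_le_apply_inf (hf : IsOperator f) {u : A}
    (hu : ∀ i, u ≤ f (Function.update (fun _ => ⊥) i u)) (v : Fin n → A) :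
    f v ⊓ u ≤ f fun i => v i ⊓ u := by
  have key : ∀ s : Finset (Fin n), f v ⊓ u ≤ f (s.piecewise (fun i => v i ⊓ u) v) := by
    intro s
    induction s using Finset.induction_on with
    | empty =>
      rw [Finset.piecewise_empty]
      exact inf_le_left
    | insert j s hj ih =>
      set w := s.piecewise (fun i => v i ⊓ u) v with hw
      rw [Finset.piecewise_insert, (hf j w).1]
      refine le_inf ?_ (inf_le_right.trans ((hu j).trans (hf.monotone ?_)))
      · rwa [← s.piecewise_eq_of_notMem (fun i => v i ⊓ u) v hj, ← hw, Function.update_eq_self]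
      · exact update_le_update_iff.mpr ⟨le_rfl, fun _ _ => bot_le⟩
  simpa using key Finset.univ

end Operators

theorem BTerm.eval_app_update {O : ℕ → Type u} {X : Type} {A : Type u} [BooleanAlgebra A] [Ops O A]
    {n : ℕ} (f : O n) (ts : Fin n → BTerm O X) (i : Fin n) (s : BTerm O X) (v : X → A) :
    (BTerm.app f (Function.update ts i s)).eval v =
      Ops.op f (Function.update (fun j => (ts j).eval v) i (s.eval v)) :=
  congrArg (Ops.op f) <| funext fun j =>
    Function.apply_update (fun _ (t : BTerm O X) => t.eval v) ts i s j

section Box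

variable {O : ℕ → Type u} [Fintype (Σ n, O n × Fin n)] {X : Type} {A B : Type u}
  [BooleanAlgebra A] [Ops O A] [BooleanAlgebra B] [Ops O B]

/-- The term `s ⊓ ⋀ f (⊥, …, s, …, ⊥)`, where the meet extends over the operation symbols `f`
and the coordinates in which `s` is inserted. -/
noncomputable def boxTerm (s : BTerm O X) : BTerm O X :=
  (Finset.univ : Finset (Σ n, O n × Fin n)).toList.foldr
    (fun p t => .inf (.app p.2.1 (Function.update (fun _ => .bot) p.2.2 s)) t) s

variable (O) in
/-- The operation on an algebra that is given by `boxTerm`. -/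
noncomputable def box (a : A) : A :=
  (boxTerm (O := O) (.var ())).eval fun _ => a

theorem le_eval_boxTerm_iff (s : BTerm O X) (v : X → A) (b : A) :
    b ≤ (boxTerm s).eval v ↔ b ≤ s.eval v ∧ ∀ (n : ℕ) (f : O n) (i : Fin n),
      b ≤ Ops.op f (Function.update (fun _ => ⊥) i (s.eval v)) := by
  have key : ∀ l : List (Σ n, O n × Fin n),
      b ≤ (l.foldr (fun p t =>
          .inf (.app p.2.1 (Function.update (fun _ => .bot) p.2.2 s)) t) s).eval v ↔
        b ≤ s.eval v ∧ ∀ p ∈ l,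
          b ≤ Ops.op p.2.1 (Function.update (fun _ => ⊥) p.2.2 (s.eval v)) := by
    intro l
    induction l with
    | nil => simp
    | cons p l ih =>
      rw [List.foldr_cons, BTerm.eval, le_inf_iff, ih, BTerm.eval_app_update, List.forall_mem_cons]
      exact and_left_comm
  rw [boxTerm, key]
  refine and_congr_right fun _ => ⟨fun h n f i => h ⟨n, f, i⟩ (by simp), fun h p _ => h _ _ _⟩

theorem le_box_iff {a b : A} : b ≤ box O a ↔ b ≤ a ∧ ∀ (n : ℕ) (f : O n) (i : Fin n),
    b ≤ Ops.op f (Function.update (fun _ => ⊥) i a) :=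
  le_eval_boxTerm_iff _ _ _

theorem eval_boxTerm (s : BTerm O X) (v : X → A) : (boxTerm s).eval v = box O (s.eval v) :=
  eq_of_forall_le_iff fun _ => (le_eval_boxTerm_iff _ _ _).trans le_box_iff.symm

theorem eval_boxTerm_iterate (k : ℕ) (s : BTerm O X) (v : X → A) :
    (boxTerm^[k] s).eval v = (box O)^[k] (s.eval v) := by
  induction k with
  | zero => rfl
  | succ k ih => rw [Function.iterate_succ_apply', Function.iterate_succ_apply', eval_boxTerm, ih]

theorem box_le (a : A) : box O a ≤ a :=
  (le_box_iff.mp le_rfl).1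

theorem box_le_op (a : A) {n : ℕ} (f : O n) (i : Fin n) :
    box O a ≤ Ops.op f (Function.update (fun _ => ⊥) i a) :=
  (le_box_iff.mp le_rfl).2 n f i

theorem iterate_box_antitone (a : A) : Antitone fun k => (box O)^[k] a :=
  antitone_nat_of_succ_le fun k => by
    rw [Function.iterate_succ_apply']
    exact box_le _

theorem box_mono (hA : IsBAO O A) : Monotone (box O : A → A) := fun _ _ h =>
  le_box_iff.mpr ⟨(box_le _).trans h, fun n f i =>
    (box_le_op _ f i).trans ((hA n f).update_mono _ i h)⟩

theorem box_top (hA : IsBAO O A) : box O (⊤ : A) = ⊤ :=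
  top_le_iff.mp <| le_box_iff.mpr ⟨le_rfl, fun n f i => (hA n f i _).2.ge⟩

theorem OpHom.map_iterate_box (h : OpHom O A B) (k : ℕ) (a : A) :
    h.toFun ((box O)^[k] a) = (box O)^[k] (h.toFun a) :=
  Function.Semiconj.iterate_right (f := h.toFun) (fun _ => h.map_eval _ _) k a

theorem IsCongruence.iterate_box {r : A → A → Prop} (hr : IsCongruence O r) (k : ℕ) {a b : A}
    (h : r a b) : r ((box O)^[k] a) ((box O)^[k] b) := by
  induction k with
  | zero => exact h
  | succ k ih =>
    rw [Function.iterate_succ_apply', Function.iterate_succ_apply']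
    exact hr.eval (fun _ => ih) _

end Box

/-! ### Definability of principal congruences from a stabilizing box -/

section EDPC

variable {O : ℕ → Type u} [Fintype (Σ n, O n × Fin n)] {A : Type u} [BooleanAlgebra A] [Ops O A]

/-- Equality modulo an element `u` with `u ≤ box O u` is a congruence. -/
theorem isCongruence_inf_eq_inf (hA : IsBAO O A) {u : A} (hu : u ≤ box O u) :
    IsCongruence O fun c d : A => c ⊓ u = d ⊓ u where
  equiv := eq_equivalence.comap _
  inf h k := by rw [inf_inf_distrib_right, h, k, ← inf_inf_distrib_right]
  sup h k := by rw [inf_sup_right, h, k, ← inf_sup_right]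
  compl {a a'} h := by
    have key : ∀ {x y : A}, x ⊓ u = y ⊓ u → xᶜ ⊓ u ≤ yᶜ ⊓ u := fun {x y} hxy =>
      le_inf (le_compl_iff_disjoint_right.mpr <| disjoint_iff.mpr <| by
        rw [inf_assoc, inf_comm u, ← hxy, ← inf_assoc, compl_inf_eq_bot, bot_inf_eq]) inf_le_right
    exact le_antisymm (key h) (key h.symm)
  op f v w h := by
    have key : ∀ {v w : Fin _ → A}, (∀ i, v i ⊓ u = w i ⊓ u) →
        Ops.op f v ⊓ u ≤ Ops.op f w ⊓ u := fun {v w} h => by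
      refine le_inf (((hA _ f).inf_le_apply_inf (fun i => hu.trans (box_le_op u f i)) v).trans ?_)
        inf_le_right
      rw [funext h]
      exact (hA _ f).monotone fun i => inf_le_left
    exact le_antisymm (key h) (key fun i => (h i).symm)

/-- If the `K`-th iterate of the box is idempotent, the congruence generated by `(a, b)` is
equality modulo the element `box^K (a ↔ b)`. -/
theorem cg_pair_iff (hA : IsBAO O A) {K : ℕ} (hK : ∀ a : A, (box O)^[K] a ≤ (box O)^[K + 1] a)
    (a b c d : A) : Cg O {(a, b)} c d ↔
      c ⊓ (box O)^[K] ((aᶜ ⊔ b) ⊓ (bᶜ ⊔ a)) = d ⊓ (box O)^[K] ((aᶜ ⊔ b) ⊓ (bᶜ ⊔ a)) := by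
  set u := (box O)^[K] ((aᶜ ⊔ b) ⊓ (bᶜ ⊔ a)) with hu
  constructor
  · refine fun h => h _ (isCongruence_inf_eq_inf hA ?_) ?_
    · rw [hu, ← Function.iterate_succ_apply' (box O)]
      exact hK _
    · rintro _ rfl
      have h0 : u ≤ (aᶜ ⊔ b) ⊓ (bᶜ ⊔ a) := iterate_box_antitone _ (Nat.zero_le K)
      refine le_antisymm (le_inf ?_ inf_le_right) (le_inf ?_ inf_le_right)
      · calc a ⊓ u ≤ a ⊓ (aᶜ ⊔ b) := inf_le_inf_left _ (h0.trans inf_le_left)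
          _ ≤ b := by rw [inf_sup_left, inf_compl_self, bot_sup_eq]; exact inf_le_right
      · calc b ⊓ u ≤ b ⊓ (bᶜ ⊔ a) := inf_le_inf_left _ (h0.trans inf_le_right)
          _ ≤ a := by rw [inf_sup_left, inf_compl_self, bot_sup_eq]; exact inf_le_right
  · intro h r hr hab
    have hab : r a b := hab _ rfl
    have hut : r u ⊤ := by
      have h1 : r ((aᶜ ⊔ b) ⊓ (bᶜ ⊔ a)) ((bᶜ ⊔ b) ⊓ (bᶜ ⊔ b)) :=
        hr.inf (hr.sup (hr.compl hab) (hr.equiv.refl b)) (hr.sup (hr.equiv.refl _) hab)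
      rw [inf_idem, compl_sup_eq_top] at h1
      have h2 := hr.iterate_box K h1
      rwa [Function.iterate_fixed (box_top hA)] at h2
    have hcd : ∀ x, r (x ⊓ u) x := fun x => by
      have := hr.inf (hr.equiv.refl x) hut
      rwa [inf_top_eq] at this
    exact hr.equiv.trans (hr.equiv.symm (hcd c)) (h ▸ hcd d)

/-- A variety of Boolean algebras with finitely many operators of positive
arity, in which some iterate of the box is idempotent, has equationally definable principal
congruences. -/
theorem hasEDPC_of_box {E : Set (BTerm O ℕ × BTerm O ℕ)} (hE : IsBAOVariety E) {K : ℕ}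
    (hK : ∀ (A : Type u) [BooleanAlgebra A] [Ops O A], InVariety E A →
      ∀ a : A, (box O)^[K] a ≤ (box O)^[K + 1] a) : HasEDPC E := by
  let u : BTerm O (Fin 4) := boxTerm^[K]
    (.inf (.sup (.compl (.var 0)) (.var 1)) (.sup (.compl (.var 1)) (.var 0)))
  refine ⟨{(.inf (.var 2) u, .inf (.var 3) u)}, Set.finite_singleton _, fun A _ _ hA a b c d => ?_⟩
  rw [cg_pair_iff (hE A hA) (hK A hA)]
  simp only [Set.mem_singleton_iff, forall_eq, BTerm.eval, u, eval_boxTerm_iterate]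
  rfl

end EDPC

section Reducts

variable {O : ℕ → Type u} {κ : ∀ n : ℕ, O n → ExtKind} {E : Set (BTerm O ℕ × BTerm O ℕ)}
  {T : Set (Σ n : ℕ, BTerm O (Fin n))}

attribute [local instance] reduct

/-! ### Term-reducts -/

theorem isBAO_reduct (hop : ∀ t ∈ T, IsOperatorTerm E t.2) {A : Type u} [BooleanAlgebra A]
    [Ops O A] (hA : InVariety E A) : IsBAO (termSig T) A :=
  fun n f => hop ⟨n, f.1⟩ f.2 A hA

/-- A homomorphism of algebras is a homomorphism of their term-reducts. -/
def OpHom.reduct (T : Set (Σ n : ℕ, BTerm O (Fin n))) {A B : Type u} [BooleanAlgebra A] [Ops O A]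
    [BooleanAlgebra B] [Ops O B] (h : OpHom O A B) : OpHom (termSig T) A B where
  toBoundedLatticeHom := h.toBoundedLatticeHom
  map_op f v := h.map_eval v f.1

theorem IsCongruence.reduct (T : Set (Σ n : ℕ, BTerm O (Fin n))) {A : Type u} [BooleanAlgebra A]
    [Ops O A] {r : A → A → Prop} (hr : IsCongruence O r) : IsCongruence (termSig T) r where
  equiv := hr.equiv
  inf := hr.inf
  sup := hr.sup
  compl := hr.compl
  op f _ _ h := hr.eval h f.1

/-- Being an operator is expressed by equations, so it passes from the term-reducts to the variety
that they generate. -/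
theorem isBAOVariety_reductEquations (hop : ∀ t ∈ T, IsOperatorTerm E t.2) :
    IsBAOVariety (reductEquations E T) := by
  intro A _ _ hA n f i v
  refine ⟨fun x y => ?_, ?_⟩
  · -- The variables `n` and `n + 1` stand for the two elements whose meet is taken.
    let ts : Fin n → BTerm (termSig T) ℕ := fun j => .var j
    let w : ℕ → A := fun j => if h : j < n then v ⟨j, h⟩ else if j = n then x else y
    have hw : (fun j => (ts j).eval w) = v := funext fun j => dif_pos j.2
    have hx : w n = x := (dif_neg (lt_irrefl n)).trans (if_pos rfl)
    have hy : w (n + 1) = y :=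
      (dif_neg (Nat.not_succ_lt_self)).trans (if_neg (Nat.succ_ne_self n))
    have key := hA (.app f (Function.update ts i (.inf (.var n) (.var (n + 1)))),
        .inf (.app f (Function.update ts i (.var n)))
          (.app f (Function.update ts i (.var (n + 1))))) (fun B _ _ hB u => by
      simp only [BTerm.eval_app_update, BTerm.eval_inf]
      exact (isBAO_reduct hop hB n f i _).1 _ _) w
    simpa only [BTerm.eval_app_update, BTerm.eval_var, BTerm.eval_inf, hw, hx, hy] using key
  · let ts : Fin n → BTerm (termSig T) ℕ := fun j => .var j
    let w : ℕ → A := fun j => if h : j < n then v ⟨j, h⟩ else ⊤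
    have hw : (fun j => (ts j).eval w) = v := funext fun j => dif_pos j.2
    have key := hA (.app f (Function.update ts i .top), .top) (fun B _ _ hB u => by
      simp only [BTerm.eval_app_update, BTerm.eval_top]
      exact (isBAO_reduct hop hB n f i _).2) w
    simpa only [BTerm.eval_app_update, BTerm.eval_top, hw] using key

variable [Fintype (Σ n, termSig T n × Fin n)]

/-! ### Fixpoints of the box in canonical extensions -/

/-- In the canonical extension the meet of all iterates of the box at `a` is a fixpoint of the box:
for each expanding operator term, the `σ`-extension at this closed element is computed from the
elements of `A` above it, and these lie above some iterate by compactness. -/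
theorem iInf_iterate_box_le (hop : ∀ t ∈ T, IsOperatorTerm E t.2)
    (hexp : ∀ t ∈ T, IsExpanding κ E t.2) {A C : Type u} [BooleanAlgebra A] [Ops O A]
    [CompleteBooleanAlgebra C] [Ops O C] {e : BoundedLatticeHom A C} (hA : InVariety E A)
    (he : IsCanonicalExtensionAlg κ e) (a : A) :
    ⨅ k, e ((box (termSig T))^[k] a) ≤ box (termSig T) (⨅ k, e ((box (termSig T))^[k] a)) := by
  set y : C := ⨅ k, e ((box (termSig T))^[k] a) with hy
  refine le_box_iff.mpr ⟨le_rfl, fun n f i => ?_⟩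
  refine le_trans ?_ (hexp ⟨n, f.1⟩ f.2 A C e hA he _)
  refine le_sSup_of_le ⟨Function.update (fun _ => ⊥) i y, fun _ => ⊤, fun j => ?_, fun j => ?_,
    le_rfl, fun _ => le_top, rfl⟩ (le_sInf ?_)
  · rcases eq_or_ne j i with rfl | hj
    · rw [Function.update_self]
      exact ⟨Set.range fun k => (box (termSig T))^[k] a, by
        rw [hy, ← Set.range_comp]
        rfl⟩
    · rw [Function.update_of_ne hj, ← map_bot e]
      exact isClosedElt_apply e ⊥
  · rw [← map_top e]
    exact isOpenElt_apply e ⊤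
  · rintro _ ⟨b, hb, rfl⟩
    have hyb : y ≤ e (b i) := by simpa using (hb i).1
    obtain ⟨k, hk⟩ := he.1.exists_le_of_iInf_le (iterate_box_antitone a) hyb
    refine (iInf_le _ (k + 1)).trans (OrderHomClass.mono e ?_)
    rw [Function.iterate_succ_apply']
    refine (box_le_op _ f i).trans ((isBAO_reduct hop hA n f).monotone ?_)
    exact update_le_iff.mpr ⟨hk, fun _ _ => bot_le⟩

/-- Every member of the variety embeds in a member in which, whenever `b` lies below all iterates
of the box at `a`, some element between `b` and `a` is a fixpoint of the box. -/
theorem exists_fixpoint_extension (hcan : ClosedUnderCanonicalExtensions κ E)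
    (hop : ∀ t ∈ T, IsOperatorTerm E t.2) (hexp : ∀ t ∈ T, IsExpanding κ E t.2)
    {A : Type u} [BooleanAlgebra A] [Ops O A] (hA : InVariety E A) :
    ∃ (C : Type u) (_ : BooleanAlgebra C) (_ : Ops O C) (h : OpHom O A C),
      InVariety E C ∧ Function.Injective h.toFun ∧
        ∀ a b : A, (∀ k, b ≤ (box (termSig T))^[k] a) →
          ∃ y : C, h.toFun b ≤ y ∧ y ≤ h.toFun a ∧ y ≤ box (termSig T) y := by
  let _ : Ops O (CanExt A) := ⟨fun f x => kindExt (κ _ f) (CanExt.emb A) (Ops.op f) x⟩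
  have he : IsCanonicalExtensionAlg κ (CanExt.emb A) :=
    ⟨CanExt.isCanonicalExtension A, fun _ _ _ => rfl⟩
  refine ⟨CanExt A, inferInstance, inferInstance, he.toOpHom, hcan A _ _ hA he, he.1.injective,
    fun a b hab => ⟨_, le_iInf fun k => OrderHomClass.mono (CanExt.emb A) (hab k), iInf_le _ 0,
      iInf_iterate_box_le hop hexp hA he a⟩⟩

/-! ### Coherence stabilizes the box -/

/-- The algebra presented by `z ≤ y ≤ x` and `y ≤ box y` satisfies, in its generators `x` and `z`,
exactly the consequences of the infinitely many relations `z ≤ box^k x`. As its subalgebra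
generated by `x` and `z` is finitely presented, the relation for one `k = K` implies all others. -/
theorem exists_iterate_box_le (hcan : ClosedUnderCanonicalExtensions κ E) (hcoh : Coherent E)
    (hop : ∀ t ∈ T, IsOperatorTerm E t.2) (hexp : ∀ t ∈ T, IsExpanding κ E t.2) :
    ∃ K : ℕ, ∀ (A : Type u) [BooleanAlgebra A] [Ops O A], InVariety E A →
      ∀ a : A, (box (termSig T))^[K] a ≤ (box (termSig T))^[K + 1] a := by
  let x : FreeAlg E (Fin 2) := FreeAlg.gen E 0
  let z : FreeAlg E (Fin 2) := FreeAlg.gen E 1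
  let x' : FreeAlg E (Fin 3) := FreeAlg.gen E 0
  let y' : FreeAlg E (Fin 3) := FreeAlg.gen E 1
  let z' : FreeAlg E (Fin 3) := FreeAlg.gen E 2
  let S : Set (FreeAlg E (Fin 3) × FreeAlg E (Fin 3)) :=
    {(z' ⊓ y', z'), (y' ⊓ x', y'), (y' ⊓ box (termSig T) y', y')}
  let π := QuotAlg.proj (isCongruence_cg (O := O) S)
  let φ : OpHom O (FreeAlg E (Fin 2)) (QuotAlg (isCongruence_cg (O := O) S)) :=
    π.comp (FreeAlg.lift FreeAlg.inVariety ![x', z'])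
  have hB : InVariety E (QuotAlg (isCongruence_cg (O := O) S)) :=
    QuotAlg.inVariety _ FreeAlg.inVariety
  have hφx : φ.toFun x = π.toFun x' := rfl
  have hφz : φ.toFun z = π.toFun z' := rfl
  -- The presented algebra satisfies `z ≤ box^k x` for all `k`.
  have hφ : ∀ k, φ.toFun (z ⊓ (box (termSig T))^[k] x) = φ.toFun z := by
    have hzy : π.toFun z' ≤ π.toFun y' := inf_eq_left.mp <|
      QuotAlg.mk_eq.mpr (cg_of_mem (p := (z' ⊓ y', z')) (by simp [S]))
    have hyx : π.toFun y' ≤ π.toFun x' := inf_eq_left.mp <|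
      QuotAlg.mk_eq.mpr (cg_of_mem (p := (y' ⊓ x', y')) (by simp [S]))
    have hyy : π.toFun y' ≤ box (termSig T) (π.toFun y') := by
      have := QuotAlg.mk_eq (hr := isCongruence_cg (O := O) S).mpr
        (cg_of_mem (p := (y' ⊓ box (termSig T) y', y')) (by simp [S]))
      exact (inf_eq_left.mp this).trans ((π.reduct T).map_iterate_box 1 y').le
    have hyk : ∀ k, π.toFun y' ≤ (box (termSig T))^[k] (π.toFun x') := by
      intro k
      induction k with
      | zero => exact hyx
      | succ k ih =>
        rw [Function.iterate_succ_apply']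
        exact hyy.trans (box_mono (isBAO_reduct hop hB) ih)
    intro k
    have h1 : φ.toFun ((box (termSig T))^[k] x) = (box (termSig T))^[k] (π.toFun x') :=
      (φ.reduct T).map_iterate_box k x
    rw [φ.map_inf, h1, hφz, inf_eq_left]
    exact hzy.trans (hyk k)
  -- These relations axiomatize the kernel of `φ`: the algebra that they present embeds in an
  -- algebra with a fixpoint of the box between `z` and `x`.
  let R : ℕ → FreeAlg E (Fin 2) → FreeAlg E (Fin 2) → Prop := fun k =>
    Cg O {(z ⊓ (box (termSig T))^[k] x, z)}
  have hRmem : ∀ k, R k (z ⊓ (box (termSig T))^[k] x) z := fun k => cg_of_mem (p := (_, _)) rfl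
  have hR : ∀ k, IsCongruence O (R k) := fun k => isCongruence_cg _
  have hmono : ∀ {k l : ℕ}, k ≤ l → ∀ {a b}, R k a b → R l a b := by
    intro k l hkl a b hab
    refine hab _ (hR l) ?_
    rintro _ rfl
    have h1 := (hR l).inf (hRmem l) ((hR l).equiv.refl ((box (termSig T))^[k] x))
    rw [inf_assoc, inf_eq_left.mpr (iterate_box_antitone x hkl)] at h1
    exact (hR l).equiv.trans ((hR l).equiv.symm h1) (hRmem l)
  have hker : ∀ {s t}, φ.toFun s = φ.toFun t → ∃ k, R k s t := by
    intro s t hst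
    let ρ := QuotAlg.proj (isCongruence_iUnion hR hmono)
    obtain ⟨C, _, _, h, hC, hinj, hfix⟩ := exists_fixpoint_extension hcan hop hexp
      (QuotAlg.inVariety (isCongruence_iUnion hR hmono) FreeAlg.inVariety)
    obtain ⟨y, hzy, hyx, hyy⟩ := hfix (ρ.toFun x) (ρ.toFun z) fun k => by
      have h1 : ρ.toFun (z ⊓ (box (termSig T))^[k] x) = ρ.toFun z :=
        QuotAlg.mk_eq.mpr ⟨k, hRmem k⟩
      rw [ρ.map_inf] at h1
      exact (inf_eq_left.mp h1).trans ((ρ.reduct T).map_iterate_box k x).le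
    let g : OpHom O (FreeAlg E (Fin 3)) C :=
      FreeAlg.lift hC ![h.toFun (ρ.toFun x), y, h.toFun (ρ.toFun z)]
    have hgS : ∀ a b, Cg O S a b → g.toFun a = g.toFun b := fun a b hab => by
      refine hab _ g.isCongruence_ker ?_
      rintro _ (rfl | rfl | rfl)
      · exact (g.map_inf _ _).trans (inf_eq_left.mpr hzy)
      · exact (g.map_inf _ _).trans (inf_eq_left.mpr hyx)
      · exact (g.map_inf _ _).trans (inf_eq_left.mpr
          (hyy.trans ((g.reduct T).map_iterate_box 1 y').ge))
    have hcomp : ∀ a, ((QuotAlg.lift (isCongruence_cg S) g hgS).comp φ).toFun a =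
        (h.comp ρ).toFun a := FreeAlg.hom_ext _ _ fun i => by
      fin_cases i <;> rfl
    refine QuotAlg.mk_eq.mp (hinj ?_)
    exact (hcomp s).symm.trans
      ((congrArg (QuotAlg.lift (isCongruence_cg S) g hgS).toFun hst).trans (hcomp t))
  -- By coherence the subalgebra generated by `x` and `z` is finitely presented.
  let q := QuotAlg.proj φ.isCongruence_ker
  have hq : ∀ {s t}, q.toFun s = q.toFun t ↔ φ.toFun s = φ.toFun t := QuotAlg.mk_eq
  have hBfp : FinitelyPresented E (QuotAlg (isCongruence_cg (O := O) S)) :=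
    ⟨hB, 3, S, π, by simp [S], QuotAlg.mk_surjective, fun _ _ => QuotAlg.mk_eq⟩
  obtain ⟨-, n, S', h, hfin, hsurj, hS'⟩ := hcoh _ hBfp (QuotAlg φ.isCongruence_ker)
    (QuotAlg.lift φ.isCongruence_ker φ fun _ _ h => h)
    (fun a b => by
      induction a using QuotAlg.ind
      induction b using QuotAlg.ind
      exact hq.mpr)
    ⟨2, fun i => q.toFun (FreeAlg.gen E i), fun a => by
      induction a using QuotAlg.ind with
      | h a =>
        induction a using FreeAlg.ind with
        | h t => exact ⟨t, by rw [← q.map_eval, FreeAlg.eval_gen]; rfl⟩⟩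
  -- The homomorphism `ψ` expresses the new generators by `x` and `z`.
  choose τ hτ using fun i => QuotAlg.mk_surjective (h.toFun (FreeAlg.gen E i))
  let ψ : OpHom O (FreeAlg E (Fin n)) (FreeAlg E (Fin 2)) := FreeAlg.lift FreeAlg.inVariety τ
  have hψ : ∀ a, (q.comp ψ).toFun a = h.toFun a := FreeAlg.hom_ext _ _ hτ
  obtain ⟨p, hp⟩ := hsurj (q.toFun x)
  obtain ⟨r, hr⟩ := hsurj (q.toFun z)
  -- The finitely many relations needed for the change of generators hold modulo a single `R K`.
  have hS'R : ∀ s ∈ S', ∃ k, R k (ψ.toFun s.1) (ψ.toFun s.2) := fun s hs =>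
    hker <| hq.mp <| (hψ _).trans <| ((hS' _ _).mpr (cg_of_mem hs)).trans (hψ _).symm
  choose! idx hidx using hS'R
  obtain ⟨k₀, hk₀⟩ := (hfin.image idx).bddAbove
  obtain ⟨k₁, hk₁⟩ := hker <| hq.mp <| (hψ p).trans hp
  obtain ⟨k₂, hk₂⟩ := hker <| hq.mp <| (hψ r).trans hr
  let K := max k₀ (max k₁ k₂)
  have hpx : R K (ψ.toFun p) x := hmono ((le_max_left _ _).trans (le_max_right _ _)) hk₁
  have hrz : R K (ψ.toFun r) z := hmono ((le_max_right _ _).trans (le_max_right _ _)) hk₂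
  have hkerR : ∀ {a b}, h.toFun a = h.toFun b → R K (ψ.toFun a) (ψ.toFun b) := fun {a b} hab =>
    (hS' a b).mp hab _ ((hR K).comap ψ) fun s hs =>
      hmono ((hk₀ ⟨s, hs, rfl⟩).trans (le_max_left _ _)) (hidx s hs)
  have hmain : R K (z ⊓ (box (termSig T))^[K + 1] x) z := by
    have h1 : h.toFun (r ⊓ (box (termSig T))^[K + 1] p) = h.toFun r := by
      have e1 : h.toFun ((box (termSig T))^[K + 1] p) = q.toFun ((box (termSig T))^[K + 1] x) :=
        ((h.reduct T).map_iterate_box _ p).trans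
          ((congrArg _ hp).trans ((q.reduct T).map_iterate_box _ x).symm)
      rw [h.map_inf, hr, e1, ← q.map_inf]
      exact hq.mpr (hφ _)
    have h2 := hkerR h1
    have e2 : ψ.toFun ((box (termSig T))^[K + 1] p) = (box (termSig T))^[K + 1] (ψ.toFun p) :=
      (ψ.reduct T).map_iterate_box _ p
    rw [ψ.map_inf, e2] at h2
    have h3 := (hR K).inf hrz (((hR K).reduct T).iterate_box (K + 1) hpx)
    exact (hR K).equiv.trans ((hR K).equiv.symm h3) ((hR K).equiv.trans h2 hrz)
  -- Finally `z` is specialized to `box^K x`.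
  refine ⟨K, fun A _ _ hA a => ?_⟩
  let g : OpHom O (FreeAlg E (Fin 2)) A := FreeAlg.lift hA ![a, (box (termSig T))^[K] a]
  have hg : ∀ k, g.toFun ((box (termSig T))^[k] x) = (box (termSig T))^[k] a := fun k =>
    (g.reduct T).map_iterate_box k x
  have hgz : g.toFun z = (box (termSig T))^[K] a := rfl
  have h1 := hmain _ g.isCongruence_ker (by
    rintro _ rfl
    rw [g.map_inf, hg, hgz, inf_idem])
  rw [g.map_inf, hg, hgz] at h1
  exact inf_eq_left.mp h1

end Reducts

end BAO

theorem theorem5p2 {O : ℕ → Type u} (κ : ∀ n : ℕ, O n → BAO.ExtKind)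
    (E : Set (BAO.BTerm O ℕ × BAO.BTerm O ℕ))
    (hBAO : BAO.IsBAOVariety E)
    (hcan : BAO.ClosedUnderCanonicalExtensions κ E)
    (hcoh : BAO.Coherent E)
    (T : Set (Σ n : ℕ, BAO.BTerm O (Fin n))) (hfin : T.Finite)
    (hexp : ∀ t ∈ T, BAO.IsExpanding κ E t.2)
    (hop : ∀ t ∈ T, BAO.IsOperatorTerm E t.2) :
    BAO.HasEDPC (BAO.reductEquations E T) := by
  have := hfin.to_subtype
  have : Finite (Σ n, BAO.termSig T n × Fin n) := by
    refine Finite.of_surjective (α := Σ t : T, Fin t.1.1)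
      (fun p => ⟨p.1.1.1, ⟨p.1.1.2, p.1.2⟩, p.2⟩) ?_
    rintro ⟨n, ⟨t, ht⟩, i⟩
    exact ⟨⟨⟨⟨n, t⟩, ht⟩, i⟩, rfl⟩
  have := Fintype.ofFinite (Σ n, BAO.termSig T n × Fin n)
  obtain ⟨K, hK⟩ := BAO.exists_iterate_box_le hcan hcoh hop hexp
  refine BAO.hasEDPC_of_box (BAO.isBAOVariety_reductEquations hop) (K := K) fun A _ _ hA a => ?_
  -- The identity `box^K v₀ = box^K v₀ ⊓ box^(K+1) v₀` holds in all term-reducts.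
  have h := hA (.inf (BAO.boxTerm^[K] (.var 0)) (BAO.boxTerm^[K + 1] (.var 0)),
    BAO.boxTerm^[K] (.var 0)) (fun B _ _ hB v => by
      simp only [BAO.BTerm.eval, BAO.eval_boxTerm_iterate]
      exact inf_eq_left.mpr (hK B hB _)) fun _ => a
  simp only [BAO.BTerm.eval, BAO.eval_boxTerm_iterate] at h
  exact inf_eq_left.mp h
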